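/- Let $d\ge 1$ and let $M$ be an integer $d\times d$ matrix all of whose eigenvalues are greater than $1$ in absolute value; put $m=|\det M|$ and let $M^*$ be the transpose of $M$. Let $D=\{s_0,\dots,s_{m-1}\}\subset\mathbb Z^d$ be a set of digits for $M$, i.e. $s_0=\mathbf 0$ and $s_i-s_j\notin M\mathbb Z^d$ for $i\ne j$, and let $D^*=\{s_0^*,\dots,s_{m-1}^*\}$ be a set of digits for $M^*$. Let $V$ be the generalized Vilenkin group of $(M,D)$: the sequences $x=(x_j)_{j\in\mathbb Z}$ with $x_j\in D$ and only finitely many nonzero $x_j$ with $j<0$, with coordinatewise addition modulo $M$ (denoted $\oplus$), the topology in which the sets $U_l=\{x: x_j=\mathbf 0\ \forall j\le l\}$, $l\in\mathbb Z$, form a neighbourhood basis of the neutral element, and the Haar measure $\mu$ with $\mu(U_0)=1$; let $V^*$ be the generalized Vilenkin group of $(M^*,D^*)$. Define $\mathcal M$ on $V$ by $(\mathcal Mx)_j=x_{j+1}$ and $\mathcal M^*$ on $V^*$ likewise; $H=\{x\in V: x_j=\mathbf 0\ \forall j>0\}$; for $k\in\mathbb Z_+$ with $m$-ary expansion $k=\sum_{j\ge0}k_jm^j$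 let $\gamma_{[k]}\in H$ be given by $(\gamma_{[k]})_{-j}=s_{k_j}$, $j\ge 0$; and set $$\chi(x,\omega)=\exp\Big(2\pi i\sum_{j\in\mathbb Z}\langle M^{-1}x_j,\omega_{1-j}\rangle\Big),\qquad \widehat\varphi(\omega)=\int_V\varphi(x)\overline{\chi(x,\omega)}\,d\mu(x),\qquad x\in V,\ \omega\in V^*.$$ A Walsh polynomial is a finite linear combination of the functions $W_k=\chi(\gamma_{[k]},\cdot)$ on $V^*$. A function $\varphi\in L_2(V)$ is refinable if there are numbers $\alpha_k$ with $\varphi(x)=\sum_{k=0}^\infty\alpha_k\varphi(\mathcal Mx\oplus\gamma_{[k]})$ for almost all $x\in V$; it is orthogonal if the system $\{\varphi(\cdot\oplus h): h\in H\}$ is orthonormal in $L_2(V)$. A mask of a compactly supported $\varphi\in L_2(V)$ is a Walsh polynomial $m_0$ with $\widehat\varphi(\omega)=m_0({\mathcal M^*}^{-1}\omega)\,\widehat\varphi({\mathcal M^*}^{-1}\omega)$ for all $\omega\in V^*$. Theorem. If a refinable function $\varphi\in L_2(V)$ with compact support is orthogonal, then it has exactly one mask $m_0$, and $$\sum_{k=0}^{m-1}\big|m_0\big({\mathcal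 M^*}^{-1}(\omega\oplus s_k^*)\big)\big|^2=1\qquad\text{for all }\omega\in V^*,$$ where $s_k^*$ is regarded as the element of $V^*$ whose $0$-th coordinate is $s_k^*$ and whose other coordinates are $\mathbf 0$. -/

import Mathlib

namespace Vilenkin

open MeasureTheory Filter Topology Matrix

noncomputable section

/-- An integer `d × d` matrix all of whose (complex) eigenvalues have absolute value `> 1`. -/
structure DilationMatrix (d : ℕ) where
  mat : Matrix (Fin d) (Fin d) ℤ
  expanding : ∀ z : ℂ,
    Module.End.HasEigenvalue (Matrix.toLin' (mat.map (Int.cast : ℤ → ℂ))) z → 1 < ‖z‖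

variable {d : ℕ}

namespace DilationMatrix

/-- The number `m = |det M|`. -/
def m (M : DilationMatrix d) : ℕ := M.mat.det.natAbs

theorem det_ne_zero (M : DilationMatrix d) : M.mat.det ≠ 0 := by
  intro h
  have h1 : (M.mat.map (Int.cast : ℤ → ℂ)).det = 0 := by
    have := (Int.castRingHom ℂ).map_det M.mat
    rw [h] at this
    simpa using this.symm
  obtain ⟨v, hv, hv0⟩ := Matrix.exists_mulVec_eq_zero_iff.mpr h1
  have h2 : Module.End.HasEigenvalue (Matrix.toLin' (M.mat.map (Int.cast : ℤ → ℂ))) 0 := by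
    apply Module.End.hasEigenvalue_of_hasEigenvector (x := v)
    refine ⟨?_, hv⟩
    rw [Module.End.mem_eigenspace_iff]
    simpa using hv0
  have := M.expanding 0 h2
  norm_num at this

theorem m_pos (M : DilationMatrix d) : 0 < M.m := Int.natAbs_pos.mpr M.det_ne_zero

/-- The transposed matrix `M*`. -/
def transpose (M : DilationMatrix d) : DilationMatrix d where
  mat := M.matᵀ
  expanding := by
    intro z hz
    apply M.expanding z
    rw [Module.End.hasEigenvalue_iff_isRoot_charpoly, Matrix.charpoly_toLin'] at hz ⊢
    rwa [← Matrix.charpoly_transpose, ← Matrix.transpose_map]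

/-- Congruence modulo `M`: `l ≡ k (mod M)` if `l - k = M s` for some integer vector `s`. -/
def Congruent (M : DilationMatrix d) (l k : Fin d → ℤ) : Prop :=
  ∃ s : Fin d → ℤ, l - k = M.mat *ᵥ s

/-- The sublattice `M ℤ^d` of `ℤ^d`. -/
def lattice (M : DilationMatrix d) : Submodule ℤ (Fin d → ℤ) := LinearMap.range M.mat.mulVecLin

theorem mk_eq_iff (M : DilationMatrix d) (l k : Fin d → ℤ) :
    (Submodule.Quotient.mk l : (Fin d → ℤ) ⧸ M.lattice) = Submodule.Quotient.mk k ↔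
      M.Congruent l k := by
  rw [Submodule.Quotient.eq]
  constructor
  · rintro ⟨s, hs⟩
    exact ⟨s, hs.symm⟩
  · rintro ⟨s, hs⟩
    exact ⟨s, hs.symm⟩

theorem card_quotient (M : DilationMatrix d) : Nat.card ((Fin d → ℤ) ⧸ M.lattice) = M.m := by
  have hinj : Function.Injective M.mat.mulVecLin := by
    rw [← LinearMap.ker_eq_bot, LinearMap.ker_eq_bot']
    intro v hv
    exact Matrix.eq_zero_of_mulVec_eq_zero M.det_ne_zero hv
  have h := Submodule.natAbs_det_equiv M.lattice (LinearEquiv.ofInjective M.mat.mulVecLin hinj)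
  rw [← h, m, ← LinearMap.det_toLin']
  rfl

end DilationMatrix

/-- A set of digits `s_0 = 0, s_1, …, s_{m-1}` for `M`: pairwise incongruent modulo `M`. -/
structure DigitSet (M : DilationMatrix d) where
  s : Fin M.m → (Fin d → ℤ)
  s_zero : s ⟨0, M.m_pos⟩ = 0
  incongruent : ∀ i j, i ≠ j → ¬ M.Congruent (s i) (s j)

namespace DigitSet

variable {M : DilationMatrix d}

/-- The set `{s_0, …, s_{m-1}}` as a type. -/
def Digit (D : DigitSet M) : Type := {v : Fin d → ℤ // ∃ i, D.s i = v}

/-- The digit `s_i`. -/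
def digit (D : DigitSet M) (i : Fin M.m) : D.Digit := ⟨D.s i, i, rfl⟩

theorem digit_bijective (D : DigitSet M) : Function.Bijective D.digit := by
  constructor
  · intro i j h
    by_contra hij
    have h' : D.s i = D.s j := congrArg Subtype.val h
    exact D.incongruent i j hij ⟨0, by simp [h']⟩
  · rintro ⟨v, i, rfl⟩
    exact ⟨i, rfl⟩

instance (D : DigitSet M) : Finite D.Digit := Finite.of_surjective _ D.digit_bijective.2

/-- The residue class of a digit modulo `M`. -/
def toQuotient (D : DigitSet M) (a : D.Digit) : (Fin d → ℤ) ⧸ M.lattice :=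
  Submodule.Quotient.mk a.1

theorem toQuotient_bijective (D : DigitSet M) : Function.Bijective D.toQuotient := by
  have hcard : Nat.card D.Digit = Nat.card ((Fin d → ℤ) ⧸ M.lattice) := by
    rw [M.card_quotient, ← Nat.card_eq_of_bijective _ D.digit_bijective, Nat.card_fin]
  have hfin : Finite ((Fin d → ℤ) ⧸ M.lattice) :=
    Nat.finite_of_card_ne_zero (by rw [M.card_quotient]; exact M.m_pos.ne')
  refine (Nat.bijective_iff_injective_and_card _).mpr ⟨?_, hcard⟩
  rintro ⟨a, i, rfl⟩ ⟨b, j, rfl⟩ h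
  have h' := (M.mk_eq_iff _ _).mp h
  by_cases hij : i = j
  · subst hij
    rfl
  · exact absurd h' (D.incongruent i j hij)

/-- Addition of digits modulo `M`: the digits represent the residue classes modulo `M`, and the
group structure of `ℤ^d / M ℤ^d` is carried over to them (see `add_congruent` and `zero_val`). -/
instance (D : DigitSet M) : AddCommGroup D.Digit :=
  (Equiv.ofBijective _ D.toQuotient_bijective).addCommGroup

theorem toQuotient_add (D : DigitSet M) (a b : D.Digit) :
    D.toQuotient (a + b) = D.toQuotient a + D.toQuotient b :=
  (Equiv.ofBijective _ D.toQuotient_bijective).apply_symm_apply _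

theorem toQuotient_zero (D : DigitSet M) : D.toQuotient 0 = 0 :=
  (Equiv.ofBijective _ D.toQuotient_bijective).apply_symm_apply _

theorem add_congruent (D : DigitSet M) (a b : D.Digit) :
    M.Congruent (a + b : D.Digit).1 (a.1 + b.1) :=
  (M.mk_eq_iff _ _).mp (D.toQuotient_add a b)

theorem digit_zero (D : DigitSet M) : D.digit ⟨0, M.m_pos⟩ = 0 := by
  apply D.toQuotient_bijective.1
  rw [D.toQuotient_zero]
  simp [toQuotient, digit, D.s_zero]

theorem zero_val (D : DigitSet M) : (0 : D.Digit).1 = 0 := by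
  rw [← D.digit_zero]
  exact D.s_zero

/-- The two-sided digit sequences that vanish at all sufficiently negative indices. -/
def seqs (D : DigitSet M) : AddSubgroup (ℤ → D.Digit) where
  carrier := {x | ∃ N : ℤ, ∀ j < N, x j = 0}
  zero_mem' := ⟨0, fun _ _ => rfl⟩
  add_mem' := by
    rintro x y ⟨N, hN⟩ ⟨K, hK⟩
    refine ⟨min N K, fun j hj => ?_⟩
    rw [Pi.add_apply, hN j (lt_of_lt_of_le hj (min_le_left _ _)),
      hK j (lt_of_lt_of_le hj (min_le_right _ _)), add_zero]
  neg_mem' := by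
    rintro x ⟨N, hN⟩
    exact ⟨N, fun j hj => by rw [Pi.neg_apply, hN j hj, neg_zero]⟩

end DigitSet

variable {M : DilationMatrix d}

/-- The generalized Vilenkin group associated with `M` and the set of digits `D`: digit sequences
with finitely many nonzero entries at negative indices, added coordinatewise modulo `M`. -/
def V (D : DigitSet M) : Type := D.seqs

namespace V

instance (D : DigitSet M) : AddCommGroup (V D) := inferInstanceAs (AddCommGroup D.seqs)

variable {D : DigitSet M}

/-- The coordinate `x_j`. -/
def coord (x : V D) (j : ℤ) : D.Digit := x.1 j

theorem coord_add (x y : V D) (j : ℤ) : (x + y).coord j = x.coord j + y.coord j := rfl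

theorem coord_neg (x : V D) (j : ℤ) : (-x).coord j = -x.coord j := rfl

theorem coord_zero (j : ℤ) : (0 : V D).coord j = 0 := rfl

theorem ext_coord {x y : V D} (h : ∀ j, x.coord j = y.coord j) : x = y :=
  Subtype.ext (funext h)

variable (D) in
/-- `U_l = {x : x_j = 0 for all j ≤ l}`. -/
def U (l : ℤ) : AddSubgroup (V D) where
  carrier := {x | ∀ j ≤ l, x.coord j = 0}
  zero_mem' := fun _ _ => rfl
  add_mem' := fun {x y} hx hy j hj => by rw [coord_add, hx j hj, hy j hj, add_zero]
  neg_mem' := fun {x} hx j hj => by rw [coord_neg, hx j hj, neg_zero]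

theorem U_anti {k l : ℤ} (h : k ≤ l) : U D l ≤ U D k :=
  fun _ hx j hj => hx j (hj.trans h)

/-- The topology in which the sets `U_l`, `l ∈ ℤ`, form a neighbourhood basis at the neutral
element (and their translates a neighbourhood basis at every point). -/
instance : TopologicalSpace (V D) where
  IsOpen S := ∀ x ∈ S, ∃ l : ℤ, ∀ u ∈ U D l, x + u ∈ S
  isOpen_univ := fun _ _ => ⟨0, fun _ _ => trivial⟩
  isOpen_inter := by
    intro S T hS hT x hx
    obtain ⟨k, hk⟩ := hS x hx.1
    obtain ⟨l, hl⟩ := hT x hx.2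
    exact ⟨max k l, fun u hu => ⟨hk u (U_anti (le_max_left _ _) hu),
      hl u (U_anti (le_max_right _ _) hu)⟩⟩
  isOpen_sUnion := by
    rintro F hF x ⟨S, hS, hx⟩
    obtain ⟨l, hl⟩ := hF S hS x hx
    exact ⟨l, fun u hu => ⟨S, hS, hl u hu⟩⟩

theorem isOpen_iff {S : Set (V D)} :
    IsOpen S ↔ ∀ x ∈ S, ∃ l : ℤ, ∀ u ∈ U D l, x + u ∈ S := Iff.rfl

theorem isOpen_coset (x : V D) (l : ℤ) : IsOpen {y : V D | y - x ∈ U D l} := by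
  rw [isOpen_iff]
  intro y hy
  refine ⟨l, fun u hu => ?_⟩
  have : y + u - x = (y - x) + u := by abel
  rw [Set.mem_ofPred_eq, this]
  exact add_mem hy hu

instance : IsTopologicalAddGroup (V D) where
  continuous_add := by
    rw [continuous_def]
    intro S hS
    rw [isOpen_prod_iff]
    intro a b hab
    obtain ⟨l, hl⟩ := isOpen_iff.mp hS _ hab
    refine ⟨_, _, isOpen_coset a l, isOpen_coset b l, by simp [zero_mem], by simp [zero_mem], ?_⟩
    rintro ⟨p, q⟩ ⟨hp, hq⟩
    have : p + q = a + b + ((p - a) + (q - b)) := by abel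
    rw [Set.mem_preimage, this]
    exact hl _ (add_mem hp hq)
  continuous_neg := by
    rw [continuous_def]
    intro S hS
    rw [isOpen_iff]
    intro x hx
    obtain ⟨l, hl⟩ := isOpen_iff.mp hS _ hx
    refine ⟨l, fun u hu => ?_⟩
    rw [Set.mem_preimage, neg_add]
    exact hl _ (neg_mem hu)

instance : MeasurableSpace (V D) := borel (V D)

instance : BorelSpace (V D) := ⟨rfl⟩

/-- The element of `U_0` with prescribed coordinates at `1, 2, 3, …`. -/
def ofFrac (a : ℕ → D.Digit) : V D :=
  ⟨fun j => if 1 ≤ j then a (j - 1).toNat else 0,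
    1, fun j hj => by simp [not_le.mpr hj]⟩

theorem range_ofFrac : Set.range (ofFrac : (ℕ → D.Digit) → V D) = (U D 0 : Set (V D)) := by
  ext x
  constructor
  · rintro ⟨a, rfl⟩ j hj
    exact if_neg (by omega)
  · intro hx
    refine ⟨fun n => x.coord (n + 1), ext_coord fun j => ?_⟩
    by_cases hj : 1 ≤ j
    · refine (if_pos hj).trans ?_
      have : (((j - 1).toNat : ℕ) : ℤ) + 1 = j := by omega
      exact congrArg x.coord this
    · exact (if_neg hj).trans (hx j (by omega)).symm

theorem isCompact_U : IsCompact (U D 0 : Set (V D)) := by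
  let _ : TopologicalSpace D.Digit := ⊥
  have : DiscreteTopology D.Digit := ⟨rfl⟩
  rw [← range_ofFrac]
  apply isCompact_range
  rw [continuous_def]
  intro S hS
  rw [isOpen_pi_iff]
  intro a ha
  obtain ⟨l, hl⟩ := isOpen_iff.mp hS _ ha
  refine ⟨Finset.range l.toNat, fun n => {a n}, fun n _ => ⟨isOpen_discrete _, rfl⟩, ?_⟩
  intro b hb
  have : ofFrac b = ofFrac a + (ofFrac b - ofFrac a) := by abel
  rw [Set.mem_preimage, this]
  apply hl
  intro j hj
  rw [sub_eq_add_neg, coord_add, coord_neg, ← sub_eq_add_neg, sub_eq_zero]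
  by_cases hj1 : 1 ≤ j
  · have hmem : (j - 1).toNat ∈ Finset.range l.toNat := by
      rw [Finset.mem_range]
      omega
    have : b (j - 1).toNat = a (j - 1).toNat := hb _ hmem
    simpa [coord, ofFrac, hj1] using this
  · simp [coord, ofFrac, hj1]

theorem isOpen_U (l : ℤ) : IsOpen (U D l : Set (V D)) := by
  rw [isOpen_iff]
  exact fun x hx => ⟨l, fun u hu => add_mem hx hu⟩

variable (D) in
/-- `U = U_0` as a compact set with nonempty interior. -/
def compactU : TopologicalSpace.PositiveCompacts (V D) where
  carrier := U D 0
  isCompact' := isCompact_U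
  interior_nonempty' := by
    rw [(isOpen_U 0).interior_eq]
    exact ⟨0, zero_mem _⟩

variable (D) in
/-- The Haar measure on `V`, normalized by `μ U = 1`. -/
def haar : Measure (V D) := Measure.addHaarMeasure (compactU D)

theorem haar_U : haar D (U D 0 : Set (V D)) = 1 := Measure.addHaarMeasure_self

/-- The dilation `(𝓜 x)_j = x_{j+1}`. -/
def dil : V D ≃ V D where
  toFun x := ⟨fun j => x.coord (j + 1), by
    obtain ⟨N, hN⟩ := x.2
    exact ⟨N - 1, fun j hj => hN _ (by omega)⟩⟩
  invFun x := ⟨fun j => x.coord (j - 1), by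
    obtain ⟨N, hN⟩ := x.2
    exact ⟨N + 1, fun j hj => hN _ (by omega)⟩⟩
  left_inv x := ext_coord fun j => congrArg x.coord (by ring)
  right_inv x := ext_coord fun j => congrArg x.coord (by ring)

variable (D) in
/-- `H = {x : x_j = 0 for all j > 0}`. -/
def H : Set (V D) := {x | ∀ j > 0, x.coord j = 0}

variable (D) in
/-- The digit `s_i` regarded as the element of `H ⊆ V` with `0`-th coordinate `s_i` and all other
coordinates zero. -/
def ofDigit (i : Fin M.m) : V D :=
  ⟨fun j => if j = 0 then D.digit i else 0, 0, fun _ hj => if_neg hj.ne⟩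

variable (D) in
/-- The element `γ_[k]` of `H` with `(γ_[k])_{-j} = s_{k_j}`, where `k = ∑ k_j m^j` is the
`m`-ary expansion of `k`, that is, `k_j = ⌊k / m^j⌋ mod m`. -/
def gam (k : ℕ) : V D :=
  ⟨fun i => if i ≤ 0 then D.digit ⟨k / M.m ^ (-i).toNat % M.m, Nat.mod_lt _ M.m_pos⟩ else 0, by
    refine ⟨-(k : ℤ), fun i hi => ?_⟩
    beta_reduce
    rw [if_pos (by omega), ← D.digit_zero]
    congr 2
    rcases (Nat.succ_le_of_lt M.m_pos).eq_or_lt with h1 | h2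
    · rw [← h1]
      exact Nat.mod_one _
    · rw [Nat.div_eq_of_lt, Nat.zero_mod]
      calc k < M.m ^ k := Nat.lt_pow_self h2
        _ ≤ M.m ^ (-i).toNat := Nat.pow_le_pow_right M.m_pos (by omega)⟩

end V

open V

variable {D : DigitSet M} {E : DigitSet M.transpose}

/-- The pairing `χ(x, ω) = exp(2πi ∑_j ⟨M⁻¹ x_j, ω_{1-j}⟩)` of `V` and `V*`; only finitely many
terms of the sum are nonzero. -/
def chi (x : V D) (ω : V E) : ℂ :=
  Complex.exp (2 * Real.pi * Complex.I *
    ((∑ᶠ j : ℤ, ((M.mat.map (Int.cast : ℤ → ℝ))⁻¹ *ᵥ (fun i => ((x.coord j).1 i : ℝ))) ⬝ᵥ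
      (fun i => ((ω.coord (1 - j)).1 i : ℝ)) : ℝ) : ℂ))

/-- The Fourier transform of an integrable function on `V`, as a function on `V*`. (A compactly
supported function in `L₂(V)` is integrable.) -/
def fourier (E : DigitSet M.transpose) (φ : V D → ℂ) (ω : V E) : ℂ :=
  ∫ x, φ x * (starRingEnd ℂ) (chi x ω) ∂haar D

/-- The Walsh function `W_k = χ(γ_[k], ·)` on `V*`. -/
def walsh (D : DigitSet M) (E : DigitSet M.transpose) (k : ℕ) (ω : V E) : ℂ := chi (gam D k) ω

/-- A Walsh polynomial: a linear combination of `W_0, …, W_{m^n - 1}` for some `n`. -/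
def IsWalshPolynomial (D : DigitSet M) (E : DigitSet M.transpose) (p : V E → ℂ) : Prop :=
  ∃ (n : ℕ) (c : ℕ → ℂ), ∀ ω, p ω = ∑ k ∈ Finset.range (M.m ^ n), c k * walsh D E k ω

/-- `φ ∈ L₂(V)` is refinable: `φ(x) = ∑_{k=0}^∞ α_k φ(𝓜x ⊕ γ_[k])` for some numbers `α_k`, as an
equality of elements of `L₂(V)`, i.e. for almost all `x`. -/
def IsRefinable (φ : V D → ℂ) : Prop :=
  MemLp φ 2 (haar D) ∧ ∃ α : ℕ → ℂ, ∀ᵐ x ∂haar D,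
    Tendsto (fun n => ∑ k ∈ Finset.range n, α k * φ (dil x + gam D k)) atTop (𝓝 (φ x))

/-- The system `{φ(· ⊕ h) : h ∈ H}` is orthonormal in `L₂(V)`. -/
def IsOrthogonal (φ : V D → ℂ) : Prop :=
  ∀ h ∈ H D, ∀ h' ∈ H D,
    (h = h' → ∫ x, φ (x + h) * (starRingEnd ℂ) (φ (x + h')) ∂haar D = 1) ∧
    (h ≠ h' → ∫ x, φ (x + h) * (starRingEnd ℂ) (φ (x + h')) ∂haar D = 0)

/-- `m₀` is a mask of `φ`: a Walsh polynomial with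
`φ̂(ω) = m₀(𝓜*⁻¹ω) φ̂(𝓜*⁻¹ω)` on `V*`. -/
def IsMask (φ : V D → ℂ) (m₀ : V E → ℂ) : Prop :=
  IsWalshPolynomial D E m₀ ∧
    ∀ ω : V E, fourier E φ ω = m₀ (dil.symm ω) * fourier E φ (dil.symm ω)

end

end Vilenkin

/-!
The function `χ` is a bicharacter for which the dilations of `V` and `V*` are adjoint, so the
Fourier transform turns a finite refinement equation `φ = ∑ α_k φ(𝓜 · ⊕ γ_[k])` into the mask
`m⁻¹ ∑ α_k W_k`; the equation is finite because `φ` has compact support. Evaluating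
`⟨φ, φ(· ⊕ h)⟩` with the refinement equation and the change of variables `𝓜` yields
`∑ α_k conj α_l = m δ_{h,0}`, the sum being over `γ_[k] = 𝓜h ⊕ γ_[l]`. In the sum of the squared
moduli of the mask over the digits, orthogonality of the characters of the finite group of digits
keeps exactly the pairs `(k, l)` with `γ_[k] ⊖ γ_[l] ∈ 𝓜H`, so that this sum is `1`. The mask is
unique because a Walsh polynomial `∑ c_k W_k` annihilating `φ̂` gives `∑ c_k φ(· ⊕ γ_[k]) = 0` by
injectivity of the Fourier transform, whence `c = 0` by orthonormality.
-/

namespace Vilenkin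

open MeasureTheory Filter Topology Matrix V
open scoped ComplexConjugate

noncomputable section

theorem one_lt_norm_det_of_forall_hasEigenvalue {K n : Type*} [NormedField K] [IsAlgClosed K]
    [Fintype n] [DecidableEq n] [Nonempty n] {A : Matrix n n K}
    (hA : ∀ z, Module.End.HasEigenvalue (toLin' A) z → 1 < ‖z‖) : 1 < ‖A.det‖ := by
  have hroots : ∀ z ∈ A.charpoly.roots, 1 < ‖z‖ := fun z hz => hA z <| by
    rw [Module.End.hasEigenvalue_iff_isRoot_charpoly, charpoly_toLin']
    exact Polynomial.isRoot_of_mem_roots hz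
  have hne : A.charpoly.roots ≠ 0 := by
    rw [← Multiset.card_pos, IsAlgClosed.card_roots_eq_natDegree, charpoly_natDegree_eq_dim]
    exact Fintype.card_pos
  rw [det_eq_prod_roots_charpoly]
  refine Multiset.prod_induction_nonempty (fun z => 1 < ‖z‖) (fun z w hz hw => ?_) hne hroots
  rw [norm_mul]
  exact one_lt_mul_of_lt_of_le hz hw.le

theorem cast_comp_add {n R : Type*} [Ring R] (a b : n → ℤ) :
    (fun i => ((a + b) i : R)) = (fun i => (a i : R)) + fun i => (b i : R) :=
  funext fun i => Int.cast_add (a i) (b i)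

theorem cast_mulVec {m n R : Type*} [Fintype n] [Ring R] (A : Matrix m n ℤ) (s : n → ℤ) :
    (fun i => ((A *ᵥ s) i : R)) = A.map (Int.cast : ℤ → R) *ᵥ fun i => (s i : R) :=
  funext ((Int.castRingHom R).map_mulVec A s)

theorem cast_dotProduct {n R : Type*} [Fintype n] [Ring R] (a b : n → ℤ) :
    ((a ⬝ᵥ b : ℤ) : R) = (fun i => (a i : R)) ⬝ᵥ fun i => (b i : R) :=
  (Int.castRingHom R).map_dotProduct a b

theorem coe_intCast_eq_zero (n : ℤ) : ((n : ℝ) : UnitAddCircle) = 0 :=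
  (AddCircle.coe_eq_zero_iff _).mpr ⟨n, by simp⟩

variable {d : ℕ} {M : DilationMatrix d} {D : DigitSet M} {E : DigitSet M.transpose}

namespace DilationMatrix

theorem transpose_m (M : DilationMatrix d) : M.transpose.m = M.m :=
  congrArg Int.natAbs (det_transpose M.mat)

theorem one_lt_m (hd : 0 < d) (M : DilationMatrix d) : 1 < M.m := by
  have : Nonempty (Fin d) := Fin.pos_iff_nonempty.mp hd
  have h := one_lt_norm_det_of_forall_hasEigenvalue M.expanding
  rw [← Int.cast_det, Complex.norm_intCast, ← Int.cast_abs, Int.abs_eq_natAbs] at h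
  exact_mod_cast h

theorem isUnit_det_map_cast (M : DilationMatrix d) :
    IsUnit (M.mat.map (Int.cast : ℤ → ℝ)).det := by
  rw [← Int.cast_det, isUnit_iff_ne_zero]
  exact_mod_cast M.det_ne_zero

end DilationMatrix

theorem DigitSet.natCard_digit (D : DigitSet M) : Nat.card D.Digit = M.m := by
  rw [← Nat.card_eq_of_bijective _ D.digit_bijective, Nat.card_fin]

/-- The class modulo `1` of `⟨M⁻¹ a, b⟩` for integer vectors `a` and `b`. Modulo `1` the pairing
descends to the residue classes of `M` and `M*`. -/
def latticePairing (M : DilationMatrix d) : (Fin d → ℤ) →+ (Fin d → ℤ) →+ UnitAddCircle :=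
  AddMonoidHom.mk' (fun a => AddMonoidHom.mk' (fun b =>
      ((((M.mat.map (Int.cast : ℤ → ℝ))⁻¹ *ᵥ fun i => (a i : ℝ)) ⬝ᵥ fun i => (b i : ℝ) : ℝ) :
        UnitAddCircle))
    fun b c => by rw [cast_comp_add, dotProduct_add, AddCircle.coe_add])
    fun a c => AddMonoidHom.ext fun b => by
      simp only [AddMonoidHom.mk'_apply, AddMonoidHom.add_apply, cast_comp_add, mulVec_add,
        add_dotProduct, AddCircle.coe_add]

theorem latticePairing_apply (a b : Fin d → ℤ) : latticePairing M a b =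
    ((((M.mat.map (Int.cast : ℤ → ℝ))⁻¹ *ᵥ fun i => (a i : ℝ)) ⬝ᵥ fun i => (b i : ℝ) : ℝ) :
      UnitAddCircle) := rfl

theorem latticePairing_mulVec_left (s b : Fin d → ℤ) : latticePairing M (M.mat *ᵥ s) b = 0 := by
  rw [latticePairing_apply, cast_mulVec, mulVec_mulVec, nonsing_inv_mul _ M.isUnit_det_map_cast,
    one_mulVec, ← cast_dotProduct, coe_intCast_eq_zero]

theorem latticePairing_mulVec_right (a t : Fin d → ℤ) :
    latticePairing M a (M.transpose.mat *ᵥ t) = 0 := by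
  have h : M.transpose.mat.map (Int.cast : ℤ → ℝ) = (M.mat.map (Int.cast : ℤ → ℝ))ᵀ := rfl
  rw [latticePairing_apply, cast_mulVec, h, mulVec_transpose, dotProduct_comm,
    ← dotProduct_mulVec, mulVec_mulVec, mul_nonsing_inv _ M.isUnit_det_map_cast, one_mulVec,
    ← cast_dotProduct, coe_intCast_eq_zero]

theorem DilationMatrix.Congruent.latticePairing_left {a a' : Fin d → ℤ} (h : M.Congruent a a')
    (b : Fin d → ℤ) : latticePairing M a b = latticePairing M a' b := by
  obtain ⟨s, hs⟩ := h
  rw [eq_add_of_sub_eq hs, map_add, AddMonoidHom.add_apply, latticePairing_mulVec_left, zero_add]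

theorem DilationMatrix.Congruent.latticePairing_right {b b' : Fin d → ℤ}
    (h : M.transpose.Congruent b b') (a : Fin d → ℤ) :
    latticePairing M a b = latticePairing M a b' := by
  obtain ⟨t, ht⟩ := h
  rw [eq_add_of_sub_eq ht, map_add, latticePairing_mulVec_right, zero_add]

theorem mem_lattice_of_latticePairing_eq_zero {a : Fin d → ℤ}
    (h : ∀ b, latticePairing M a b = 0) : a ∈ M.lattice := by
  have hint : ∀ i, ∃ n : ℤ, (n : ℝ) =
      ((M.mat.map (Int.cast : ℤ → ℝ))⁻¹ *ᵥ fun i => (a i : ℝ)) i := fun i => by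
    have hcast : (fun j => ((Pi.single i (1 : ℤ) : Fin d → ℤ) j : ℝ)) = Pi.single i 1 := by
      ext j
      simp [Pi.single_apply]
    have hi := h (Pi.single i 1)
    rw [latticePairing_apply, hcast, dotProduct_single, mul_one, AddCircle.coe_eq_zero_iff] at hi
    simpa using hi
  choose s hs using hint
  have hMs : (fun i => ((M.mat *ᵥ s) i : ℝ)) = fun i => (a i : ℝ) := by
    rw [cast_mulVec, funext hs, mulVec_mulVec, mul_nonsing_inv _ M.isUnit_det_map_cast,
      one_mulVec]
  exact ⟨s, funext fun i => Int.cast_injective (congrFun hMs i)⟩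

variable (D E) in
/-- The pairing of digits induced by `latticePairing`; it identifies the group of digits of `M*`
with the dual of the group of digits of `M`. -/
def digitPairing : D.Digit →+ E.Digit →+ UnitAddCircle :=
  AddMonoidHom.mk' (fun a => AddMonoidHom.mk' (fun b => latticePairing M a.1 b.1)
    fun b c => by rw [(E.add_congruent b c).latticePairing_right, map_add])
    fun a c => AddMonoidHom.ext fun b => by
      simp only [AddMonoidHom.mk'_apply, AddMonoidHom.add_apply,
        (D.add_congruent a c).latticePairing_left, map_add]

theorem eq_zero_of_digitPairing_eq_zero {a : D.Digit} (h : digitPairing D E a = 0) : a = 0 := by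
  have hlat : a.1 ∈ M.lattice := mem_lattice_of_latticePairing_eq_zero fun b => by
    obtain ⟨b', hb'⟩ := E.toQuotient_bijective.2 (Submodule.Quotient.mk b)
    rw [← ((M.transpose.mk_eq_iff _ _).mp hb').latticePairing_right]
    exact DFunLike.congr_fun h b'
  apply D.toQuotient_bijective.1
  rw [D.toQuotient_zero]
  exact (Submodule.Quotient.mk_eq_zero _).mpr hlat

open Classical in
theorem sum_toCircle_digitPairing (a : D.Digit) :
    ∑ k : Fin M.transpose.m, ((digitPairing D E a (E.digit k)).toCircle : ℂ) =
      if a = 0 then (M.m : ℂ) else 0 := by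
  have := Fintype.ofFinite E.Digit
  let ψ : AddChar E.Digit ℂ :=
    (Circle.coeHom.compAddChar AddCircle.toCircle_addChar).compAddMonoidHom (digitPairing D E a)
  have hψ : ψ = 0 ↔ a = 0 := by
    refine ⟨fun h => eq_zero_of_digitPairing_eq_zero (E := E) (AddMonoidHom.ext fun b => ?_), ?_⟩
    · apply AddCircle.injective_toCircle one_ne_zero
      rw [AddMonoidHom.zero_apply, AddCircle.toCircle_zero]
      exact Circle.coe_injective (DFunLike.congr_fun h b)
    · rintro rfl
      ext b
      simp [ψ]
  have hcard : Fintype.card E.Digit = M.m := by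
    rw [← Nat.card_eq_fintype_card, E.natCard_digit, M.transpose_m]
  have hsum := AddChar.sum_eq_ite ψ
  simp only [hψ, hcard] at hsum
  rw [← hsum]
  exact Fintype.sum_bijective E.digit E.digit_bijective _ _ fun _ => rfl

namespace V

theorem coord_sub (x y : V D) (j : ℤ) : (x - y).coord j = x.coord j - y.coord j := rfl

theorem exists_forall_lt_coord_eq_zero (x : V D) : ∃ N : ℤ, ∀ j < N, x.coord j = 0 := x.2

/-- The element of `V` whose `j`-th coordinate is `a` and whose other coordinates vanish. -/
def single (j : ℤ) (a : D.Digit) : V D :=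
  ⟨fun l => if l = j then a else 0, j, fun _ hl => if_neg hl.ne⟩

theorem coord_single_same (j : ℤ) (a : D.Digit) : (single j a).coord j = a :=
  if_pos rfl

theorem coord_single_of_ne {j l : ℤ} (h : l ≠ j) (a : D.Digit) : (single j a).coord l = 0 :=
  if_neg h

theorem ofDigit_eq_single (i : Fin M.m) : ofDigit D i = single 0 (D.digit i) := rfl

theorem coord_dil (x : V D) (j : ℤ) : (dil x).coord j = x.coord (j + 1) := rfl

theorem dil_add (x y : V D) : dil (x + y) = dil x + dil y := rfl

theorem dil_symm_sub (x y : V D) : dil.symm (x - y) = dil.symm x - dil.symm y := rfl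

end V

theorem finite_setOf_coord_ne_zero (x : V D) (ω : V E) :
    {j : ℤ | x.coord j ≠ 0 ∧ ω.coord (1 - j) ≠ 0}.Finite := by
  obtain ⟨N, hN⟩ := x.exists_forall_lt_coord_eq_zero
  obtain ⟨K, hK⟩ := ω.exists_forall_lt_coord_eq_zero
  refine (Set.finite_Icc N (1 - K)).subset fun j hj => ⟨?_, ?_⟩
  · exact not_lt.mp fun h => hj.1 (hN j h)
  · exact not_lt.mp fun h => hj.2 (hK (1 - j) (by omega))

theorem hasFiniteSupport_digitPairing_coord (x : V D) (ω : V E) :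
    (fun j : ℤ => digitPairing D E (x.coord j) (ω.coord (1 - j))).HasFiniteSupport :=
  (finite_setOf_coord_ne_zero x ω).subset fun j hj =>
    ⟨fun h => hj (by simp [h]), fun h => hj (by simp [h])⟩

variable (D E) in
/-- The pairing of `V` and `V*`, whose exponential is `chi`. -/
def pairing : V D →+ V E →+ UnitAddCircle :=
  AddMonoidHom.mk' (fun x => AddMonoidHom.mk'
      (fun ω => ∑ᶠ j : ℤ, digitPairing D E (x.coord j) (ω.coord (1 - j)))
    fun ω η => by
      simp only [coord_add, map_add]
      exact finsum_add_distrib (hasFiniteSupport_digitPairing_coord x ω)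
        (hasFiniteSupport_digitPairing_coord x η))
    fun x y => AddMonoidHom.ext fun ω => by
      simp only [AddMonoidHom.mk'_apply, AddMonoidHom.add_apply, coord_add, map_add]
      exact finsum_add_distrib (hasFiniteSupport_digitPairing_coord x ω)
        (hasFiniteSupport_digitPairing_coord y ω)

theorem pairing_apply (x : V D) (ω : V E) :
    pairing D E x ω = ∑ᶠ j : ℤ, digitPairing D E (x.coord j) (ω.coord (1 - j)) := rfl

theorem pairing_dil (x : V D) (ω : V E) : pairing D E (dil x) ω = pairing D E x (dil ω) := by
  rw [pairing_apply, pairing_apply]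
  refine finsum_eq_of_bijective (· + 1) (Equiv.addRight (1 : ℤ)).bijective fun j => ?_
  rw [coord_dil, coord_dil, sub_add_eq_sub_sub_swap, sub_self, zero_sub, neg_add_eq_sub]

theorem pairing_single (x : V D) (j : ℤ) (b : E.Digit) :
    pairing D E x (single (1 - j) b) = digitPairing D E (x.coord j) b := by
  rw [pairing_apply, finsum_eq_single _ j, coord_single_same]
  intro l hl
  rw [coord_single_of_ne (by omega), map_zero]

theorem chi_eq_toCircle_pairing (x : V D) (ω : V E) :
    chi x ω = (pairing D E x ω).toCircle := by
  have hfin : (fun j : ℤ => ((M.mat.map (Int.cast : ℤ → ℝ))⁻¹ *ᵥ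
      fun i => ((x.coord j).1 i : ℝ)) ⬝ᵥ fun i => ((ω.coord (1 - j)).1 i : ℝ)).HasFiniteSupport :=
    (finite_setOf_coord_ne_zero x ω).subset fun j hj =>
      ⟨fun h => hj (by simp [h, D.zero_val, dotProduct, mulVec]),
        fun h => hj (by simp [h, E.zero_val, dotProduct])⟩
  have hpair : pairing D E x ω = (QuotientAddGroup.mk' (AddSubgroup.zmultiples (1 : ℝ)))
      (∑ᶠ j : ℤ, ((M.mat.map (Int.cast : ℤ → ℝ))⁻¹ *ᵥ fun i => ((x.coord j).1 i : ℝ)) ⬝ᵥ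
        fun i => ((ω.coord (1 - j)).1 i : ℝ)) :=
    ((QuotientAddGroup.mk' (AddSubgroup.zmultiples (1 : ℝ))).map_finsum hfin).symm
  rw [hpair, QuotientAddGroup.mk'_apply, AddCircle.toCircle_apply_mk, Circle.coe_exp, chi, div_one]
  congr 1
  push_cast
  ring

theorem chi_add_left (x y : V D) (ω : V E) : chi (x + y) ω = chi x ω * chi y ω := by
  simp only [chi_eq_toCircle_pairing, map_add, AddMonoidHom.add_apply, AddCircle.toCircle_add,
    Circle.coe_mul]

theorem chi_add_right (x : V D) (ω η : V E) : chi x (ω + η) = chi x ω * chi x η := by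
  simp only [chi_eq_toCircle_pairing, map_add, AddCircle.toCircle_add, Circle.coe_mul]

theorem chi_zero_left (ω : V E) : chi (0 : V D) ω = 1 := by
  rw [chi_eq_toCircle_pairing, map_zero, AddMonoidHom.zero_apply, AddCircle.toCircle_zero,
    Circle.coe_one]

theorem chi_zero_right (x : V D) : chi x (0 : V E) = 1 := by
  rw [chi_eq_toCircle_pairing, map_zero, AddCircle.toCircle_zero, Circle.coe_one]

theorem norm_chi (x : V D) (ω : V E) : ‖chi x ω‖ = 1 := by
  rw [chi_eq_toCircle_pairing, Circle.norm_coe]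

theorem conj_chi (x : V D) (ω : V E) : conj (chi x ω) = chi (-x) ω := by
  rw [chi_eq_toCircle_pairing, chi_eq_toCircle_pairing, map_neg, AddMonoidHom.neg_apply,
    AddCircle.toCircle_neg, Circle.coe_inv_eq_conj]

theorem chi_dil (x : V D) (ω : V E) : chi (dil x) ω = chi x (dil ω) := by
  rw [chi_eq_toCircle_pairing, chi_eq_toCircle_pairing, pairing_dil]

theorem chi_dil_symm (x : V D) (ω : V E) : chi x (dil.symm ω) = chi (dil.symm x) ω := by
  rw [← dil.apply_symm_apply x, chi_dil, dil.apply_symm_apply, dil.symm_apply_apply]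

open Classical in
theorem sum_chi_single (x : V D) (j : ℤ) :
    ∑ k : Fin M.transpose.m, chi x (single (1 - j) (E.digit k)) =
      if x.coord j = 0 then (M.m : ℂ) else 0 := by
  simp only [chi_eq_toCircle_pairing, pairing_single]
  exact sum_toCircle_digitPairing (x.coord j)

namespace V

theorem isLocallyConstant_of_forall_exists_U {α : Type*} {f : V D → α}
    (hf : ∀ x, ∃ l, ∀ u ∈ U D l, f (x + u) = f x) : IsLocallyConstant f := fun s x hx => by
  obtain ⟨l, hl⟩ := hf x
  exact ⟨l, fun u hu => by rwa [Set.mem_preimage, hl u hu]⟩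

theorem isLocallyConstant_coord (j : ℤ) : IsLocallyConstant fun x : V D => x.coord j :=
  isLocallyConstant_of_forall_exists_U fun x =>
    ⟨j, fun u hu => by rw [coord_add, hu j le_rfl, add_zero]⟩

variable (D) in
/-- The projection of `V` onto finitely many coordinates; its fibres are the cylinder sets. -/
def restrict (J : Finset ℤ) (x : V D) : J → D.Digit := fun j => x.coord j

theorem isLocallyConstant_restrict (J : Finset ℤ) : IsLocallyConstant (restrict D J) := by
  obtain ⟨l, hl⟩ := J.exists_le
  exact isLocallyConstant_of_forall_exists_U fun x => ⟨l, fun u hu => funext fun j => by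
    rw [restrict, coord_add, hu j (hl j j.2), add_zero, restrict]⟩

instance : T2Space (V D) where
  t2 x y hxy := by
    obtain ⟨j, hj⟩ : ∃ j, x.coord j ≠ y.coord j := by
      by_contra! h
      exact hxy (ext_coord h)
    exact ⟨_, _, (isLocallyConstant_coord j).isOpen_fiber _,
      (isLocallyConstant_coord j).isOpen_fiber _, rfl, rfl,
      Disjoint.preimage (coord · j) (Set.disjoint_singleton.mpr hj)⟩

instance : LocallyCompactSpace (V D) := (compactU D).locallyCompactSpace_of_addGroup

theorem dil_mem_U_iff {x : V D} {l : ℤ} : dil x ∈ U D l ↔ x ∈ U D (l + 1) :=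
  ⟨fun h j hj => by simpa [coord_dil] using h (j - 1) (by omega),
    fun h j hj => h (j + 1) (by omega)⟩

variable (D) in
/-- The dilation `dil` as an automorphism of the topological group `V`. -/
def dilEquiv : V D ≃ₜ+ V D where
  toEquiv := dil
  map_add' := dil_add
  continuous_toFun := continuous_def.mpr fun S hS x hx => by
    obtain ⟨l, hl⟩ := hS _ hx
    exact ⟨l + 1, fun u hu => hl (dil u) (dil_mem_U_iff.mpr hu)⟩
  continuous_invFun := continuous_def.mpr fun S hS x hx => by
    obtain ⟨l, hl⟩ := hS _ hx
    refine ⟨l - 1, fun u hu => hl (dil.symm u) ?_⟩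
    rwa [← sub_add_cancel l 1, ← dil_mem_U_iff, dil.apply_symm_apply]

theorem dil_mem_U_neg_succ_iff {x : V D} {n : ℕ} :
    dil x ∈ U D (-(n + 1 : ℕ)) ↔ x ∈ U D (-n) := by
  rw [dil_mem_U_iff, Nat.cast_succ, neg_add, neg_add_cancel_right]

theorem isCompact_U_neg (n : ℕ) : IsCompact (U D (-n) : Set (V D)) := by
  induction n with
  | zero => simpa using isCompact_U (D := D)
  | succ n ih =>
    have himage : (U D (-(n + 1 : ℕ)) : Set (V D)) = dil '' U D (-n) := by
      ext x
      rw [dil.image_eq_preimage_symm, Set.mem_preimage, SetLike.mem_coe, SetLike.mem_coe,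
        ← dil_mem_U_neg_succ_iff (x := dil.symm x), dil.apply_symm_apply]
    rw [himage]
    exact ih.image (dilEquiv D).continuous_toFun

theorem exists_mem_U_neg (x : V D) : ∃ n : ℕ, x ∈ U D (-n) := by
  obtain ⟨N, hN⟩ := x.exists_forall_lt_coord_eq_zero
  exact ⟨(1 - N).toNat, fun j hj => hN j (by omega)⟩

theorem exists_subset_U_neg {K : Set (V D)} (hK : IsCompact K) :
    ∃ n : ℕ, K ⊆ U D (-n) := by
  refine hK.elim_directed_cover (fun n : ℕ => (U D (-n) : Set (V D))) (fun n => isOpen_U _)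
    (fun x _ => Set.mem_iUnion.mpr (exists_mem_U_neg x)) ?_
  exact directed_of_isDirected_le fun k l hkl => U_anti (by omega)

instance : SigmaCompactSpace (V D) :=
  ⟨⟨fun n : ℕ => U D (-n), isCompact_U_neg, Set.iUnion_eq_univ_iff.mpr exists_mem_U_neg⟩⟩

instance : (haar D).IsAddHaarMeasure :=
  inferInstanceAs (Measure.addHaarMeasure (compactU D)).IsAddHaarMeasure

instance : (haar D).Regular := inferInstanceAs (Measure.addHaarMeasure (compactU D)).Regular

theorem sub_single_mem_U_succ_iff {x : V D} {l : ℤ} {a : D.Digit} :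
    x - single (l + 1) a ∈ U D (l + 1) ↔ x.coord (l + 1) = a ∧ x ∈ U D l := by
  constructor
  · refine fun h => ⟨?_, fun j hj => ?_⟩
    · simpa [coord_sub, coord_single_same, sub_eq_zero] using h (l + 1) le_rfl
    · simpa [coord_sub, coord_single_of_ne (show j ≠ l + 1 by omega)] using h j (by omega)
  · rintro ⟨hxa, hx⟩ j hj
    obtain rfl | hne := eq_or_ne j (l + 1)
    · rw [coord_sub, coord_single_same, hxa, sub_self]
    · rw [coord_sub, coord_single_of_ne hne, hx j (by omega), sub_zero]

theorem m_mul_haar_U_succ (l : ℤ) : M.m * haar D (U D (l + 1)) = haar D (U D l) := by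
  have := Fintype.ofFinite D.Digit
  have hfiber : ∀ a, haar D ((coord · (l + 1)) ⁻¹' {a} ∩ U D l) = haar D (U D (l + 1)) := by
    intro a
    rw [← measure_preimage_add_right (haar D) (-single (l + 1) a) (U D (l + 1))]
    congr 1
    ext x
    rw [Set.mem_preimage, ← sub_eq_add_neg]
    exact sub_single_mem_U_succ_iff.symm
  have hmeas : ∀ a, MeasurableSet ((fun x : V D => x.coord (l + 1)) ⁻¹' {a}) := fun a =>
    ((isLocallyConstant_coord (l + 1)).isOpen_fiber a).measurableSet
  have h := sum_measure_preimage_singleton (μ := (haar D).restrict (U D l)) Finset.univ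
    fun a _ => hmeas a
  simp only [Measure.restrict_apply (hmeas _), hfiber, Finset.sum_const, nsmul_eq_mul,
    Finset.card_univ, ← Nat.card_eq_fintype_card, D.natCard_digit] at h
  simpa using h

theorem addEquivAddHaarChar_dilEquiv : addEquivAddHaarChar (dilEquiv D) = M.m := by
  have hpre : dilEquiv D ⁻¹' U D 0 = (U D (0 + 1) : Set (V D)) := Set.ext fun _ => dil_mem_U_iff
  have hchar := addEquivAddHaarChar_smul_preimage (haar D) (X := U D 0) (dilEquiv D)
  rw [hpre, haar_U, ENNReal.smul_def, smul_eq_mul] at hchar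
  have hm := m_mul_haar_U_succ (D := D) 0
  rw [haar_U] at hm
  have h := (ENNReal.eq_inv_of_mul_eq_one_left hchar).trans
    (ENNReal.eq_inv_of_mul_eq_one_left hm).symm
  exact_mod_cast h

theorem integral_comp_dil {F : Type*} [NormedAddCommGroup F] [NormedSpace ℝ F] (f : V D → F) :
    ∫ x, f (dil x) ∂haar D = (M.m : ℝ)⁻¹ • ∫ x, f x ∂haar D := by
  have hmap : ∫ x, f x ∂(haar D).map (dilEquiv D) = ∫ x, f (dil x) ∂haar D :=
    (dilEquiv D).toHomeomorph.measurableEmbedding.integral_map f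
  have hm : (M.m : ℝ) ≠ 0 := Nat.cast_ne_zero.mpr M.m_pos.ne'
  rw [eq_inv_smul_iff₀ hm]
  conv_rhs => rw [← addEquivAddHaarChar_smul_map (haar D) (dilEquiv D)]
  rw [integral_smul_nnreal_measure, hmap, addEquivAddHaarChar_dilEquiv, NNReal.smul_def,
    NNReal.coe_natCast]

end V

theorem exists_forall_mem_U_chi_eq_one (ω : V E) : ∃ l, ∀ u ∈ U D l, chi u ω = 1 := by
  obtain ⟨N, hN⟩ := ω.exists_forall_lt_coord_eq_zero
  refine ⟨1 - N, fun u hu => ?_⟩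
  have hpair : pairing D E u ω = 0 := finsum_eq_zero_of_forall_eq_zero fun j => by
    obtain hj | hj := le_or_gt j (1 - N)
    · rw [hu j hj, map_zero, AddMonoidHom.zero_apply]
    · rw [hN (1 - j) (by omega), map_zero]
  rw [chi_eq_toCircle_pairing, hpair, AddCircle.toCircle_zero, Circle.coe_one]

theorem continuous_chi_left (ω : V E) : Continuous fun x : V D => chi x ω := by
  obtain ⟨l, hl⟩ := exists_forall_mem_U_chi_eq_one (D := D) ω
  exact (isLocallyConstant_of_forall_exists_U fun x =>
    ⟨l, fun u hu => by rw [chi_add_left, hl u hu, mul_one]⟩).continuous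

theorem integrable_mul_conj_chi {μ : Measure (V D)} {f : V D → ℂ} (hf : Integrable f μ)
    (ω : V E) : Integrable (fun x => f x * conj (chi x ω)) μ :=
  hf.mul_bdd (c := 1)
    (Complex.continuous_conj.comp (continuous_chi_left ω)).aestronglyMeasurable
    (Eventually.of_forall fun x => by rw [RCLike.norm_conj, norm_chi])

theorem fourier_comp_add_right (f : V D → ℂ) (a : V D) (ω : V E) :
    fourier E (fun x => f (x + a)) ω = chi a ω * fourier E f ω := by
  rw [fourier, fourier, ← integral_add_right_eq_self _ (-a), ← integral_const_mul]
  congr 1 with x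
  rw [neg_add_cancel_right, chi_add_left, map_mul, conj_chi (-a), neg_neg]
  ring

theorem fourier_comp_dil (f : V D → ℂ) (ω : V E) :
    fourier E (fun x => f (dil x)) ω = (M.m : ℂ)⁻¹ * fourier E f (dil.symm ω) := by
  have h := integral_comp_dil fun x => f x * conj (chi x (dil.symm ω))
  simp only [chi_dil, dil.apply_symm_apply, Complex.real_smul, Complex.ofReal_inv,
    Complex.ofReal_natCast] at h
  exact h

theorem fourier_sum_mul_comp_add_right {ι : Type*} {f : V D → ℂ} (hf : Integrable f (haar D))
    (s : Finset ι) (c : ι → ℂ) (a : ι → V D) (ω : V E) :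
    fourier E (fun x => ∑ i ∈ s, c i * f (x + a i)) ω =
      (∑ i ∈ s, c i * chi (a i) ω) * fourier E f ω := by
  simp only [fourier, Finset.sum_mul, mul_assoc]
  rw [integral_finsetSum _ fun i _ =>
    (integrable_mul_conj_chi (hf.comp_add_right (a i)) ω).const_mul (c i)]
  refine Finset.sum_congr rfl fun i _ => ?_
  rw [integral_const_mul]
  exact congrArg (c i * ·) (fourier_comp_add_right f (a i) ω)

theorem setIntegral_inter_coord_fiber_eq_zero {s : Set (V D)} {g : V D → ℂ}
    (hg : IntegrableOn g s (haar D))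
    (h0 : ∀ ω : V E, ∫ x in s, g x * conj (chi x ω) ∂haar D = 0) (j : ℤ) (a : D.Digit)
    (ω : V E) :
    ∫ x in s ∩ {x | x.coord j = a}, g x * conj (chi x ω) ∂haar D = 0 := by
  classical
  have hm : (M.m : ℂ) ≠ 0 := Nat.cast_ne_zero.mpr M.m_pos.ne'
  let χ (x : V D) (k : Fin M.transpose.m) : ℂ := chi x (V.single (1 - j) (E.digit k))
  -- Fourier inversion on the finite group of digits at place `j`.
  have hindicator : ∀ x : V D,
      Set.indicator {x | x.coord j = a} (fun x => g x * conj (chi x ω)) x =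
        ∑ k, (M.m : ℂ)⁻¹ * χ (V.single j a) k *
          (g x * conj (chi x (ω + V.single (1 - j) (E.digit k)))) := fun x => by
    have hsum : ∑ k, χ (V.single j a - x) k = if x.coord j = a then (M.m : ℂ) else 0 := by
      simp only [χ, sum_chi_single, coord_sub, coord_single_same, sub_eq_zero, eq_comm (a := a)]
    have hterm : ∀ k, (M.m : ℂ)⁻¹ * χ (V.single j a) k *
        (g x * conj (chi x (ω + V.single (1 - j) (E.digit k)))) =
          (M.m : ℂ)⁻¹ * (g x * conj (chi x ω)) * χ (V.single j a - x) k := fun k => by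
      simp only [χ, chi_add_right, map_mul, sub_eq_add_neg, chi_add_left, ← conj_chi]
      ring
    simp only [hterm, ← Finset.mul_sum, hsum, Set.indicator_apply, Set.mem_ofPred_eq]
    split_ifs
    · field_simp
    · rw [mul_zero]
  rw [← setIntegral_indicator ((isLocallyConstant_coord j).isOpen_fiber a).measurableSet]
  simp only [hindicator]
  rw [integral_finsetSum _ fun k _ => (integrable_mul_conj_chi hg _).const_mul _]
  exact Finset.sum_eq_zero fun k _ => by rw [integral_const_mul, h0, mul_zero]

theorem setIntegral_cylinder_eq_zero {g : V D → ℂ} (hg : Integrable g (haar D))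
    (h0 : ∀ ω : V E, fourier E g ω = 0) (J : Finset ℤ) (a : ℤ → D.Digit) (ω : V E) :
    ∫ x in {x : V D | ∀ j ∈ J, x.coord j = a j}, g x * conj (chi x ω) ∂haar D = 0 := by
  induction J using Finset.induction_on generalizing ω with
  | empty => simpa [fourier] using h0 ω
  | insert j J _ ih =>
    have hset : {x : V D | ∀ i ∈ insert j J, x.coord i = a i} =
        {x : V D | ∀ i ∈ J, x.coord i = a i} ∩ {x | x.coord j = a j} := by
      ext x
      simp [and_comm]
    rw [hset]
    exact setIntegral_inter_coord_fiber_eq_zero hg.integrableOn ih j (a j) ω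

theorem setIntegral_preimage_restrict_eq_zero {g : V D → ℂ} (hg : Integrable g (haar D))
    (h0 : ∀ ω : V E, fourier E g ω = 0) (J : Finset ℤ) (T : Set (J → D.Digit)) :
    ∫ x in restrict D J ⁻¹' T, g x ∂haar D = 0 := by
  classical
  have hfiber : ∀ t : J → D.Digit, ∫ x in restrict D J ⁻¹' {t}, g x ∂haar D = 0 := fun t => by
    have hset : restrict D J ⁻¹' {t} =
        {x | ∀ j ∈ J, x.coord j = if h : j ∈ J then t ⟨j, h⟩ else 0} := by
      ext x
      simp +contextual [restrict, funext_iff]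
    have h := setIntegral_cylinder_eq_zero hg h0 J (fun j => if h : j ∈ J then t ⟨j, h⟩ else 0) 0
    simpa only [chi_zero_right, map_one, mul_one, hset] using h
  have hT : T.Finite := T.toFinite
  rw [← hT.coe_toFinset, ← Finset.set_biUnion_preimage_singleton, integral_biUnion_finset]
  · exact Finset.sum_eq_zero fun t _ => hfiber t
  · exact fun t _ => ((isLocallyConstant_restrict J).isOpen_fiber t).measurableSet
  · exact fun s _ t _ hst => Disjoint.preimage _ (Set.disjoint_singleton.mpr hst)
  · exact fun _ _ => hg.integrableOn

theorem V.antitone_preimage_restrict_image (K : Set (V D)) :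
    Antitone fun l : ℕ =>
      restrict D (Finset.Icc (-l) l) ⁻¹' (restrict D (Finset.Icc (-l) l) '' K) := by
  rintro k l hkl x ⟨y, hy, h⟩
  refine ⟨y, hy, funext fun ⟨j, hj⟩ => congrFun h ⟨j, ?_⟩⟩
  rw [Finset.mem_Icc] at hj ⊢
  omega

theorem V.iInter_preimage_restrict_image {K : Set (V D)} (hK : IsCompact K) :
    ⋂ l : ℕ, restrict D (Finset.Icc (-l) l) ⁻¹' (restrict D (Finset.Icc (-l) l) '' K) = K := by
  refine (Set.subset_iInter fun l => Set.subset_preimage_image _ K).antisymm' fun x hx => ?_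
  obtain ⟨n, hn⟩ := exists_subset_U_neg hK
  obtain ⟨p, hp⟩ := exists_mem_U_neg x
  rw [← hK.isClosed.closure_eq, mem_closure_iff]
  intro S hS hxS
  obtain ⟨l, hl⟩ := V.isOpen_iff.mp hS x hxS
  obtain ⟨y, hy, hyx⟩ := Set.mem_iInter.mp hx (max l.toNat (max n p))
  refine ⟨y, ?_, hy⟩
  rw [← add_sub_cancel x y]
  refine hl _ fun j hj => ?_
  rw [coord_sub, sub_eq_zero]
  by_cases hj' : j ≤ -(max n p : ℕ)
  · rw [hn hy j (by omega), hp j (by omega)]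
  · exact congrFun hyx ⟨j, by rw [Finset.mem_Icc]; omega⟩

theorem ae_eq_zero_of_fourier_eq_zero {g : V D → ℂ} (hg : Integrable g (haar D))
    (h0 : ∀ ω : V E, fourier E g ω = 0) : g =ᵐ[haar D] 0 := by
  refine ae_eq_zero_of_forall_setIntegral_isCompact_eq_zero hg fun K hK => ?_
  have h := tendsto_setIntegral_of_antitone (μ := haar D) (f := g)
    (fun l => (isLocallyConstant_restrict _ _).measurableSet)
    (antitone_preimage_restrict_image K) ⟨0, hg.integrableOn⟩
  simp only [setIntegral_preimage_restrict_eq_zero hg h0, iInter_preimage_restrict_image hK] at h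
  exact tendsto_nhds_unique h tendsto_const_nhds

theorem eq_of_forall_div_pow_mod_eq {b k l : ℕ} (hb : 1 < b)
    (h : ∀ j, k / b ^ j % b = l / b ^ j % b) : k = l := by
  have hmod : ∀ n, k % b ^ n = l % b ^ n := fun n => by
    induction n with
    | zero => rw [pow_zero, Nat.mod_one, Nat.mod_one]
    | succ n ih => rw [Nat.mod_pow_succ, Nat.mod_pow_succ, ih, h]
  have hlt : max k l < b ^ max k l := Nat.lt_pow_self hb
  rw [← Nat.mod_eq_of_lt ((le_max_left k l).trans_lt hlt), hmod,
    Nat.mod_eq_of_lt ((le_max_right k l).trans_lt hlt)]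

namespace V

theorem zero_mem_H : (0 : V D) ∈ H D := fun _ _ => rfl

theorem add_mem_H {a b : V D} (ha : a ∈ H D) (hb : b ∈ H D) : a + b ∈ H D := fun j hj => by
  rw [coord_add, ha j hj, hb j hj, add_zero]

theorem sub_mem_H {a b : V D} (ha : a ∈ H D) (hb : b ∈ H D) : a - b ∈ H D := fun j hj => by
  rw [coord_sub, ha j hj, hb j hj, sub_zero]

theorem dil_mem_H {a : V D} (ha : a ∈ H D) : dil a ∈ H D := fun j hj => ha (j + 1) (by omega)

theorem gam_mem_H (k : ℕ) : gam D k ∈ H D := fun _ hj => if_neg (by omega)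

theorem coord_gam_neg (k j : ℕ) :
    (gam D k).coord (-j) = D.digit ⟨k / M.m ^ j % M.m, Nat.mod_lt _ M.m_pos⟩ := by
  have h : (gam D k).coord (-j) =
      D.digit ⟨k / M.m ^ (-(-(j : ℤ))).toNat % M.m, Nat.mod_lt _ M.m_pos⟩ := if_pos (by omega)
  simpa using h

theorem coord_gam_neg_eq_zero_iff {k j : ℕ} :
    (gam D k).coord (-j) = 0 ↔ k / M.m ^ j % M.m = 0 := by
  rw [coord_gam_neg, ← D.digit_zero, D.digit_bijective.1.eq_iff, Fin.mk.injEq]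

theorem gam_injective (hm : 1 < M.m) : Function.Injective (gam D) := fun k l h =>
  eq_of_forall_div_pow_mod_eq hm fun j => by
    simpa [coord_gam_neg, D.digit_bijective.1.eq_iff] using congrArg (coord · (-j)) h

theorem gam_mem_U_neg_iff (hm : 1 < M.m) {k n : ℕ} : gam D k ∈ U D (-n) ↔ k < M.m ^ n := by
  rw [← Nat.div_eq_zero_iff_lt (pow_pos M.m_pos n)]
  constructor
  · refine fun h => eq_of_forall_div_pow_mod_eq hm fun j => ?_
    rw [Nat.div_div_eq_div_mul, ← pow_add, Nat.zero_div, Nat.zero_mod,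
      ← coord_gam_neg_eq_zero_iff (D := D)]
    exact h _ (by omega)
  · intro h i hi
    obtain ⟨j, rfl⟩ : ∃ j : ℕ, i = -(n + j : ℕ) := ⟨(-i - n).toNat, by omega⟩
    rw [coord_gam_neg_eq_zero_iff, pow_add, ← Nat.div_div_eq_div_mul, h, Nat.zero_div,
      Nat.zero_mod]

end V

/-- The refinement equation with finitely many coefficients `α₀, …, α_{N-1}`. -/
def SatisfiesRefinementEquation (φ : V D → ℂ) (N : ℕ) (α : ℕ → ℂ) : Prop :=
  ∀ᵐ x ∂haar D, φ x = ∑ k ∈ Finset.range N, α k * φ (dil x + gam D k)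

theorem IsRefinable.exists_satisfiesRefinementEquation (hm : 1 < M.m) {φ : V D → ℂ}
    (hφ : IsRefinable φ) (hs : HasCompactSupport φ) :
    ∃ n α, SatisfiesRefinementEquation φ (M.m ^ n) α := by
  obtain ⟨-, α, hα⟩ := hφ
  obtain ⟨n, hn⟩ := exists_subset_U_neg hs.isCompact
  have hzero : ∀ x, x ∉ U D (-n) → φ x = 0 := fun x hx =>
    image_eq_zero_of_notMem_tsupport fun h => hx (hn h)
  have hle : U D (-n) ≤ U D (-(n + 1 : ℕ)) := U_anti (by omega)
  refine ⟨n + 1, α, hα.mono fun x hx => ?_⟩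
  by_cases hxn : x ∈ U D (-n)
  · have htail : ∀ k ∉ Finset.range (M.m ^ (n + 1)), α k * φ (dil x + gam D k) = 0 := by
      intro k hk
      rw [Finset.mem_range, ← gam_mem_U_neg_iff (D := D) hm] at hk
      rw [hzero _ fun h => hk ?_, mul_zero]
      exact (add_mem_cancel_left (dil_mem_U_neg_succ_iff.mpr hxn)).mp (hle h)
    exact tendsto_nhds_unique hx
      ((hasSum_sum_of_ne_finset_zero htail).tendsto_sum_nat)
  · rw [hzero x hxn]
    refine (Finset.sum_eq_zero fun k hk => ?_).symm
    rw [Finset.mem_range, ← gam_mem_U_neg_iff (D := D) hm] at hk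
    rw [hzero _ fun h => hxn ?_, mul_zero]
    exact dil_mem_U_neg_succ_iff.mp ((add_mem_cancel_right hk).mp (hle h))

theorem IsRefinable.integrable {φ : V D → ℂ} (hφ : IsRefinable φ) (hs : HasCompactSupport φ) :
    Integrable φ (haar D) :=
  (integrableOn_iff_integrable_of_support_subset (subset_tsupport φ)).mp
    ((hφ.1.locallyIntegrable one_le_two).integrableOn_isCompact hs)

/-- The mask `m⁻¹ ∑ α_k W_k` of the refinement equation with coefficients `α₀, …, α_{N-1}`. -/
def refinementMask (D : DigitSet M) (E : DigitSet M.transpose) (N : ℕ) (α : ℕ → ℂ) (ω : V E) :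
    ℂ :=
  (M.m : ℂ)⁻¹ * ∑ k ∈ Finset.range N, α k * walsh D E k ω

theorem isWalshPolynomial_refinementMask (n : ℕ) (α : ℕ → ℂ) :
    IsWalshPolynomial D E (refinementMask D E (M.m ^ n) α) :=
  ⟨n, fun k => (M.m : ℂ)⁻¹ * α k, fun ω => by
    simp only [refinementMask, Finset.mul_sum, mul_assoc]⟩

theorem SatisfiesRefinementEquation.isMask_refinementMask {φ : V D → ℂ}
    (hφ : Integrable φ (haar D)) {n : ℕ} {α : ℕ → ℂ}
    (hα : SatisfiesRefinementEquation φ (M.m ^ n) α) :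
    IsMask φ (refinementMask D E (M.m ^ n) α) := by
  refine ⟨isWalshPolynomial_refinementMask n α, fun ω => ?_⟩
  let f (x : V D) : ℂ := ∑ k ∈ Finset.range (M.m ^ n), α k * φ (x + gam D k)
  calc fourier E φ ω = fourier E (fun x => f (dil x)) ω :=
        integral_congr_ae (hα.mono fun x hx => congrArg (· * conj (chi x ω)) hx)
    _ = (M.m : ℂ)⁻¹ * fourier E f (dil.symm ω) := fourier_comp_dil f ω
    _ = (M.m : ℂ)⁻¹ * ((∑ k ∈ Finset.range (M.m ^ n), α k * walsh D E k (dil.symm ω)) *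
          fourier E φ (dil.symm ω)) :=
        congrArg _ (fourier_sum_mul_comp_add_right hφ _ α (gam D) (dil.symm ω))
    _ = refinementMask D E (M.m ^ n) α (dil.symm ω) * fourier E φ (dil.symm ω) :=
        (mul_assoc _ _ _).symm

theorem integrable_comp_add_mul_conj_comp_add {φ : V D → ℂ} (hφ : MemLp φ 2 (haar D))
    (a b : V D) : Integrable (fun x => φ (x + a) * conj (φ (x + b))) (haar D) :=
  (hφ.comp_measurePreserving (measurePreserving_add_right (haar D) a)).integrable_mul
    (hφ.comp_measurePreserving (measurePreserving_add_right (haar D) b)).star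

open Classical in
theorem IsOrthogonal.integral_mul_conj {φ : V D → ℂ} (horth : IsOrthogonal φ) {a b : V D}
    (ha : a ∈ H D) (hb : b ∈ H D) :
    ∫ x, φ (x + a) * conj (φ (x + b)) ∂haar D = if a = b then 1 else 0 := by
  split_ifs with h
  · exact (horth a ha b hb).1 h
  · exact (horth a ha b hb).2 h

open Classical in
theorem IsOrthogonal.integral_sum_mul_conj_sum {φ : V D → ℂ} (horth : IsOrthogonal φ)
    (hφ : MemLp φ 2 (haar D)) {ι κ : Type*} (s : Finset ι) (t : Finset κ) (c : ι → ℂ)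
    (e : κ → ℂ) {a : ι → V D} {b : κ → V D} (ha : ∀ i, a i ∈ H D) (hb : ∀ j, b j ∈ H D) :
    ∫ x, (∑ i ∈ s, c i * φ (x + a i)) * conj (∑ j ∈ t, e j * φ (x + b j)) ∂haar D =
      ∑ p ∈ s ×ˢ t with a p.1 = b p.2, c p.1 * conj (e p.2) := by
  have hexpand : ∀ x, (∑ i ∈ s, c i * φ (x + a i)) * conj (∑ j ∈ t, e j * φ (x + b j)) =
      ∑ p ∈ s ×ˢ t, c p.1 * conj (e p.2) * (φ (x + a p.1) * conj (φ (x + b p.2))) := fun x => by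
    rw [map_sum, Finset.sum_mul_sum, ← Finset.sum_product']
    exact Finset.sum_congr rfl fun p _ => by rw [map_mul, mul_mul_mul_comm]
  simp only [hexpand]
  rw [integral_finsetSum _ fun p _ =>
    (integrable_comp_add_mul_conj_comp_add hφ (a p.1) (b p.2)).const_mul _, Finset.sum_filter]
  refine Finset.sum_congr rfl fun p _ => ?_
  rw [integral_const_mul, horth.integral_mul_conj (ha _) (hb _), mul_ite, mul_one, mul_zero]

theorem IsOrthogonal.coeff_eq_zero {φ : V D → ℂ} (horth : IsOrthogonal φ)
    (hφ : MemLp φ 2 (haar D)) {ι : Type*} {s : Finset ι} {c : ι → ℂ} {a : ι → V D}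
    (ha : ∀ i, a i ∈ H D) (hinj : Function.Injective a)
    (h0 : (fun x => ∑ i ∈ s, c i * φ (x + a i)) =ᵐ[haar D] 0) {i : ι} (hi : i ∈ s) :
    c i = 0 := by
  classical
  have hfilter : {p ∈ s ×ˢ {i} | a p.1 = a p.2} = {(i, i)} := by
    ext ⟨j, k⟩
    simp only [Finset.mem_filter, Finset.mem_product, Finset.mem_singleton, hinj.eq_iff,
      Prod.mk.injEq]
    constructor
    · rintro ⟨⟨-, rfl⟩, rfl⟩
      exact ⟨rfl, rfl⟩
    · rintro ⟨rfl, rfl⟩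
      exact ⟨⟨hi, rfl⟩, rfl⟩
  have h := horth.integral_sum_mul_conj_sum hφ s {i} c 1 ha ha
  rw [hfilter, Finset.sum_singleton, Pi.one_apply, map_one, mul_one] at h
  rw [← h]
  exact integral_eq_zero_of_ae (h0.mono fun x hx => mul_eq_zero_of_left hx _)

open Classical in
theorem IsOrthogonal.sum_coeff_mul_conj_coeff {φ : V D → ℂ} (horth : IsOrthogonal φ)
    (hφ : MemLp φ 2 (haar D)) {N : ℕ} {α : ℕ → ℂ} (hα : SatisfiesRefinementEquation φ N α)
    {h : V D} (hh : h ∈ H D) :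
    ∑ p ∈ Finset.range N ×ˢ Finset.range N with gam D p.1 = dil h + gam D p.2,
      α p.1 * conj (α p.2) = if h = 0 then (M.m : ℂ) else 0 := by
  let f (x : V D) : ℂ := ∑ k ∈ Finset.range N, α k * φ (x + gam D k)
  let g (x : V D) : ℂ := ∑ k ∈ Finset.range N, α k * φ (x + (dil h + gam D k))
  have hg : ∀ᵐ x ∂haar D, φ (x + h) = g (dil x) := by
    filter_upwards [(measurePreserving_add_right (haar D) h).quasiMeasurePreserving.ae hα]
      with x hx
    simpa only [dil_add, add_assoc] using hx
  have hscale : ∫ x, φ x * conj (φ (x + h)) ∂haar D =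
      (M.m : ℂ)⁻¹ * ∫ x, f x * conj (g x) ∂haar D := by
    have hdil := integral_comp_dil fun x => f x * conj (g x)
    rw [Complex.real_smul, Complex.ofReal_inv, Complex.ofReal_natCast] at hdil
    rw [← hdil]
    refine integral_congr_ae ?_
    filter_upwards [hα, hg] with x hx hx'
    rw [hx, hx']
  have hone := horth.integral_mul_conj zero_mem_H hh
  simp only [add_zero, eq_comm (a := (0 : V D))] at hone
  have hm : (M.m : ℂ) ≠ 0 := Nat.cast_ne_zero.mpr M.m_pos.ne'
  rw [← horth.integral_sum_mul_conj_sum hφ _ _ α α gam_mem_H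
    fun k => add_mem_H (dil_mem_H hh) (gam_mem_H k), ← mul_boole, ← hone, hscale,
    mul_inv_cancel_left₀ hm]

open Classical in
theorem sum_norm_sq_sum_mul_chi_add_single {ι : Type*} (s : Finset ι) (c : ι → ℂ) (y : ι → V D)
    (j : ℤ) (ω : V E) :
    (∑ i : Fin M.transpose.m,
        ‖∑ k ∈ s, c k * chi (y k) (ω + V.single (1 - j) (E.digit i))‖ ^ 2 : ℝ) =
      (M.m : ℂ) * ∑ p ∈ s ×ˢ s with (y p.1 - y p.2).coord j = 0,
        c p.1 * conj (c p.2) * chi (y p.1 - y p.2) ω := by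
  have hexpand : ∀ η : V E, ((‖∑ k ∈ s, c k * chi (y k) η‖ ^ 2 : ℝ) : ℂ) =
      ∑ p ∈ s ×ˢ s, c p.1 * conj (c p.2) * chi (y p.1 - y p.2) η := fun η => by
    rw [Complex.ofReal_pow, ← Complex.mul_conj', map_sum, Finset.sum_mul_sum,
      ← Finset.sum_product']
    refine Finset.sum_congr rfl fun p _ => ?_
    rw [map_mul, conj_chi, mul_mul_mul_comm, ← chi_add_left, ← sub_eq_add_neg]
  rw [Complex.ofReal_sum]
  simp only [hexpand]
  simp only [chi_add_right, ← mul_assoc]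
  rw [Finset.sum_comm, Finset.mul_sum, Finset.sum_filter]
  refine Finset.sum_congr rfl fun p _ => ?_
  rw [← Finset.mul_sum, sum_chi_single]
  split_ifs
  · ring
  · rw [mul_zero]

theorem V.dil_symm_mem_H {a : V D} (ha : a ∈ H D) (h : (dil.symm a).coord 1 = 0) :
    dil.symm a ∈ H D := fun j hj => by
  obtain rfl | hne := eq_or_ne j 1
  · exact h
  · exact ha (j - 1) (by omega)

open Classical in
theorem IsOrthogonal.sum_coeff_mul_conj_coeff_mul_chi {φ : V D → ℂ} (horth : IsOrthogonal φ)
    (hφ : MemLp φ 2 (haar D)) {N : ℕ} {α : ℕ → ℂ} (hα : SatisfiesRefinementEquation φ N α)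
    (ω : V E) :
    ∑ p ∈ Finset.range N ×ˢ Finset.range N with
        (dil.symm (gam D p.1) - dil.symm (gam D p.2)).coord 1 = 0,
      α p.1 * conj (α p.2) * chi (dil.symm (gam D p.1) - dil.symm (gam D p.2)) ω = M.m := by
  let δ (p : ℕ × ℕ) : V D := dil.symm (gam D p.1) - dil.symm (gam D p.2)
  let R := Finset.range N ×ˢ Finset.range N
  let P : Finset (ℕ × ℕ) := {p ∈ R | (δ p).coord 1 = 0}
  have hfiber : ∀ h ∈ H D, ∑ p ∈ P with δ p = h, α p.1 * conj (α p.2) * chi (δ p) ω =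
      (if h = 0 then (M.m : ℂ) else 0) * chi h ω := fun h hh => by
    have hδ : ∀ p, δ p = h ↔ gam D p.1 = dil h + gam D p.2 := fun p => by
      rw [← sub_eq_iff_eq_add, ← dil.symm_apply_eq, dil_symm_sub]
    have hP : {p ∈ P | δ p = h} = {p ∈ R | gam D p.1 = dil h + gam D p.2} := by
      rw [Finset.filter_filter]
      refine Finset.filter_congr fun p _ => ?_
      rw [← hδ, and_iff_right_of_imp]
      exact fun hp => hp ▸ hh 1 one_pos
    rw [← horth.sum_coeff_mul_conj_coeff hφ hα hh, ← hP, Finset.sum_mul]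
    exact Finset.sum_congr rfl fun p hp => by rw [(Finset.mem_filter.mp hp).2]
  have hmaps : ∀ p ∈ P, δ p ∈ insert 0 (P.image δ) := fun p hp =>
    Finset.mem_insert_of_mem (Finset.mem_image_of_mem δ hp)
  have hH : ∀ h ∈ insert 0 (P.image δ), h ∈ H D := by
    refine (Finset.forall_mem_insert _ _ _).mpr ⟨zero_mem_H, Finset.forall_mem_image.mpr ?_⟩
    exact fun p hp => dil_symm_mem_H (sub_mem_H (gam_mem_H p.1) (gam_mem_H p.2))
      (Finset.mem_filter.mp hp).2
  rw [← Finset.sum_fiberwise_of_maps_to hmaps, Finset.sum_congr rfl fun h hh => hfiber h (hH h hh),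
    Finset.sum_eq_single_of_mem 0 (Finset.mem_insert_self _ _)]
  · rw [if_pos rfl, chi_zero_left, mul_one]
  · exact fun h _ hne => by rw [if_neg hne, zero_mul]

theorem IsOrthogonal.sum_norm_sq_refinementMask {φ : V D → ℂ} (horth : IsOrthogonal φ)
    (hφ : MemLp φ 2 (haar D)) {N : ℕ} {α : ℕ → ℂ} (hα : SatisfiesRefinementEquation φ N α)
    (ω : V E) :
    ∑ i : Fin M.transpose.m, ‖refinementMask D E N α (dil.symm (ω + ofDigit E i))‖ ^ 2 = 1 := by
  have hm : (M.m : ℝ) ≠ 0 := Nat.cast_ne_zero.mpr M.m_pos.ne'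
  have hsum : ∑ i : Fin M.transpose.m, ‖∑ k ∈ Finset.range N,
      α k * chi (dil.symm (gam D k)) (ω + V.single (1 - 1) (E.digit i))‖ ^ 2 =
        (M.m : ℝ) * M.m := by
    have h := sum_norm_sq_sum_mul_chi_add_single (Finset.range N) α
      (fun k => dil.symm (gam D k)) 1 ω
    rw [horth.sum_coeff_mul_conj_coeff_mul_chi hφ hα ω] at h
    exact_mod_cast h
  have hmask : ∀ i, ‖refinementMask D E N α (dil.symm (ω + ofDigit E i))‖ ^ 2 =
      (M.m : ℝ)⁻¹ ^ 2 * ‖∑ k ∈ Finset.range N,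
        α k * chi (dil.symm (gam D k)) (ω + V.single (1 - 1) (E.digit i))‖ ^ 2 := fun i => by
    simp only [refinementMask, walsh, chi_dil_symm, norm_mul, mul_pow, norm_inv,
      Complex.norm_natCast, ofDigit_eq_single, sub_self]
  simp only [hmask]
  rw [← Finset.mul_sum, hsum]
  field_simp

theorem IsWalshPolynomial.mem_span {p : V E → ℂ} (hp : IsWalshPolynomial D E p) :
    p ∈ Submodule.span ℂ (Set.range (walsh D E)) := by
  obtain ⟨n, c, hc⟩ := hp
  have hsum : p = ∑ k ∈ Finset.range (M.m ^ n), c k • walsh D E k := by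
    ext ω
    simpa [Finset.sum_apply] using hc ω
  rw [hsum]
  exact Submodule.sum_mem _ fun k _ =>
    Submodule.smul_mem _ _ (Submodule.subset_span ⟨k, rfl⟩)

theorem IsOrthogonal.eq_zero_of_mul_fourier_eq_zero (hm : 1 < M.m) {φ : V D → ℂ}
    (horth : IsOrthogonal φ) (hφ : MemLp φ 2 (haar D)) (hint : Integrable φ (haar D))
    {p : V E → ℂ} (hp : p ∈ Submodule.span ℂ (Set.range (walsh D E)))
    (h0 : ∀ ω, p ω * fourier E φ ω = 0) : p = 0 := by
  obtain ⟨c, rfl⟩ := Finsupp.mem_span_range_iff_exists_finsupp.mp hp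
  have hsum : (fun x => ∑ k ∈ c.support, c k * φ (x + gam D k)) =ᵐ[haar D] 0 := by
    refine ae_eq_zero_of_fourier_eq_zero (E := E)
      (integrable_finsetSum _ fun k _ => (hint.comp_add_right (gam D k)).const_mul _) fun ω => ?_
    rw [fourier_sum_mul_comp_add_right hint, ← h0 ω]
    simp [Finsupp.sum, Finset.sum_apply, walsh]
  have hc : c = 0 := Finsupp.support_eq_empty.mp <| Finset.eq_empty_of_forall_notMem fun k hk =>
    Finsupp.mem_support_iff.mp hk (horth.coeff_eq_zero hφ gam_mem_H (gam_injective hm) hsum hk)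
  rw [hc, Finsupp.sum_zero_index]

theorem IsMask.unique (hm : 1 < M.m) {φ : V D → ℂ} (horth : IsOrthogonal φ)
    (hφ : MemLp φ 2 (haar D)) (hint : Integrable φ (haar D)) {p q : V E → ℂ}
    (hp : IsMask φ p) (hq : IsMask φ q) : p = q := by
  refine sub_eq_zero.mp <| horth.eq_zero_of_mul_fourier_eq_zero hm hφ hint
    (Submodule.sub_mem _ hp.1.mem_span hq.1.mem_span) fun ω => ?_
  have h := (hp.2 (dil ω)).symm.trans (hq.2 (dil ω))
  rw [dil.symm_apply_apply] at h
  rw [Pi.sub_apply, sub_mul, h, sub_self]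

end

end Vilenkin

theorem theorem5 {d : ℕ} (hd : 0 < d) (M : Vilenkin.DilationMatrix d)
    (D : Vilenkin.DigitSet M) (Dstar : Vilenkin.DigitSet M.transpose)
    (φ : Vilenkin.V D → ℂ) (hrefinable : Vilenkin.IsRefinable φ)
    (hsupport : HasCompactSupport φ) (horthogonal : Vilenkin.IsOrthogonal φ) :
    (∃! m₀ : Vilenkin.V Dstar → ℂ, Vilenkin.IsMask φ m₀) ∧
    ∀ m₀ : Vilenkin.V Dstar → ℂ, Vilenkin.IsMask φ m₀ →
      ∀ ω : Vilenkin.V Dstar,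
        ∑ k : Fin M.transpose.m,
          ‖m₀ (Vilenkin.V.dil.symm (ω + Vilenkin.V.ofDigit Dstar k))‖ ^ 2 = 1 := by
  have hm := M.one_lt_m hd
  have hint := hrefinable.integrable hsupport
  obtain ⟨n, α, hα⟩ := hrefinable.exists_satisfiesRefinementEquation hm hsupport
  have hmask : Vilenkin.IsMask φ (Vilenkin.refinementMask D Dstar (M.m ^ n) α) :=
    hα.isMask_refinementMask hint
  have hunique : ∀ m₀ : Vilenkin.V Dstar → ℂ, Vilenkin.IsMask φ m₀ →
      m₀ = Vilenkin.refinementMask D Dstar (M.m ^ n) α := fun m₀ hm₀ =>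
    hm₀.unique hm horthogonal hrefinable.1 hint hmask
  refine ⟨⟨_, hmask, hunique⟩, fun m₀ hm₀ ω => ?_⟩
  rw [hunique m₀ hm₀]
  exact horthogonal.sum_norm_sq_refinementMask hrefinable.1 hα ω
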